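/- Let $M$ be a smooth ($C^\infty$, finite-dimensional) manifold and let $(\omega,\theta)$ be a locally conformally symplectic structure on $M$: $\omega$ is a nondegenerate $2$-form, $\theta$ is a closed $1$-form, and $d\omega+\theta\wedge\omega=0$. Let $\sharp_\omega:T^*M\to TM$ be the inverse of $X\mapsto -i_X\omega$, and put $$\pi(\alpha,\beta)=\omega(\sharp_\omega\alpha,\sharp_\omega\beta),\qquad \xi=\sharp_\omega\theta,\qquad \beta(\sharp_\pi\alpha)=\pi(\alpha,\beta),\qquad \sharp_{\omega,\theta}(\alpha)=\sharp_{\pi,\xi}(\alpha)=\sharp_\pi(\alpha)+\alpha(\xi)\,\xi .$$ Let $g$ be a pseudo-Riemannian metric on $M$, with musical isomorphisms $\flat_g$, $\sharp_g=\flat_g^{-1}$ and cometric $g^*(\alpha,\beta)=g(\sharp_g\alpha,\sharp_g\beta)$, and assume that $g$ is associated with $(\omega,\theta)$, i.e. that $\sharp_{\omega,\theta}$ is an isometry: $g(\sharp_{\omega,\theta}\alpha,\sharp_{\omega,\theta}\beta)=g^*(\alpha,\beta)$ for all $\alpha,\beta$. Let $J$ be the endomorphism of $TM$ with $g(J\sharp_g\alpha,\sharp_g\beta)=\pi(\alpha,\beta)$,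 let $\lambda=g(\xi,\xi)\flat_g(\xi)-\flat_g(J\xi)$, and for $1$-forms $\alpha,\beta$ let $$[\alpha,\beta]_\pi=\mathcal L_{\sharp_\pi\alpha}\beta-\mathcal L_{\sharp_\pi\beta}\alpha-d(\pi(\alpha,\beta)),$$ $$[\alpha,\beta]^g_{\pi,\xi}=[\alpha,\beta]_\pi+\alpha(\xi)(\mathcal L_\xi\beta-\beta)-\beta(\xi)(\mathcal L_\xi\alpha-\alpha)-\pi(\alpha,\beta)\lambda .$$ Let $\nabla$ be the Levi-Civita connection of $g$ and let $\mathcal D$ be the contravariant Levi-Civita derivative of $(\pi,\xi,g)$, i.e. the contravariant derivative with anchor $\sharp_{\pi,\xi}$ (so $\mathcal D_\alpha\beta$ is $C^\infty(M)$-linear in $\alpha$ and additive in $\beta$, with $\mathcal D_\alpha(f\beta)=f\mathcal D_\alpha\beta+\sharp_{\pi,\xi}(\alpha)(f)\,\beta$) that satisfies $\mathcal D_\alpha\beta-\mathcal D_\beta\alpha=[\alpha,\beta]^g_{\pi,\xi}$ and $\sharp_{\pi,\xi}(\alpha)\cdot g^*(\beta,\gamma)=g^*(\mathcal D_\alpha\beta,\gamma)+g^*(\beta,\mathcal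 D_\alpha\gamma)$. Then $\mathcal D$ and $\nabla$ exist, and for all smooth $1$-forms $\alpha,\beta,\gamma$ on $M$ $$\sharp_{\omega,\theta}(\mathcal D_\alpha\beta)=\nabla_{\sharp_{\omega,\theta}(\alpha)}\,\sharp_{\omega,\theta}(\beta),\qquad \mathcal D\pi(\alpha,\beta,\gamma)=\nabla\omega\big(\sharp_{\omega,\theta}(\alpha),\sharp_{\omega,\theta}(\beta),\sharp_{\omega,\theta}(\gamma)\big),$$ where $\mathcal D\pi(\alpha,\beta,\gamma)=\sharp_{\pi,\xi}(\alpha)\cdot\pi(\beta,\gamma)-\pi(\mathcal D_\alpha\beta,\gamma)-\pi(\beta,\mathcal D_\alpha\gamma)$ and $\nabla\omega(X,Y,Z)=X\cdot\omega(Y,Z)-\omega(\nabla_XY,Z)-\omega(Y,\nabla_XZ)$. -/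

import Mathlib

open Bundle Manifold VectorField

namespace LCS

noncomputable section

variable {E : Type*} [NormedAddCommGroup E] [NormedSpace ℝ E]
  {H : Type*} [TopologicalSpace H] (I : ModelWithCorners ℝ E H)
  {M : Type*} [TopologicalSpace M] [ChartedSpace H M]

/-! ### Tensor fields -/

/-- The cotangent space of `M` at `x`. -/
abbrev Cotangent (x : M) : Type _ := TangentSpace I x →L[ℝ] ℝ

variable (M) in
/-- Vector fields: sections of `TM`, without regularity. -/
abbrev VField : Type _ := Π x : M, TangentSpace I x

variable (M) in
/-- One-forms: sections of `T*M`, without regularity. -/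
abbrev OneForm : Type _ := Π x : M, Cotangent I x

variable (M) in
/-- Covariant `2`-tensor fields, without regularity. -/
abbrev Cov2 : Type _ := Π x : M, TangentSpace I x →L[ℝ] TangentSpace I x →L[ℝ] ℝ

variable (M) in
/-- Contravariant `2`-tensor fields, without regularity. -/
abbrev Contra2 : Type _ := Π x : M, Cotangent I x →L[ℝ] Cotangent I x →L[ℝ] ℝ

variable {I}

section Smoothness

variable [IsManifold I 1 M]

/-- A one-form of class `C^∞`, as a section of the cotangent bundle. -/
def SmoothOneForm (α : OneForm I M) : Prop :=
  ContMDiff I (I.prod 𝓘(ℝ, E →L[ℝ] ℝ)) ((⊤ : ℕ∞) : WithTop ℕ∞)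
    (fun x ↦ TotalSpace.mk' (E →L[ℝ] ℝ) x (α x))

/-- A one-form that is differentiable at `x`, as a section of the cotangent bundle. -/
def OneFormDiffAt (α : OneForm I M) (x : M) : Prop :=
  MDifferentiableAt I (I.prod 𝓘(ℝ, E →L[ℝ] ℝ)) (fun y ↦ TotalSpace.mk' (E →L[ℝ] ℝ) y (α y)) x

/-- A covariant `2`-tensor field of class `C^∞`, as a section of `Hom(TM, T*M)`. -/
def SmoothCov2 (b : Cov2 I M) : Prop :=
  ContMDiff I (I.prod 𝓘(ℝ, E →L[ℝ] E →L[ℝ] ℝ)) ((⊤ : ℕ∞) : WithTop ℕ∞)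
    (fun x ↦ TotalSpace.mk' (E →L[ℝ] E →L[ℝ] ℝ) x (b x))

/-- Pseudo-Riemannian metrics: smooth symmetric nondegenerate covariant `2`-tensor fields. -/
structure IsPseudoRiemannianMetric (g : Cov2 I M) : Prop where
  smooth : SmoothCov2 g
  symm : ∀ x v w, g x v w = g x w v
  nondegenerate : ∀ x v, (∀ w, g x v w = 0) → v = 0

/-- Nondegenerate differential `2`-forms. -/
structure IsNondegenerateTwoForm (ω : Cov2 I M) : Prop where
  smooth : SmoothCov2 ω
  alt : ∀ x v, ω x v v = 0
  nondegenerate : ∀ x v, (∀ w, ω x v w = 0) → v = 0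

end Smoothness

/-! ### Exterior calculus -/

/-- `dθ(X, Y) = X(θ(Y)) - Y(θ(X)) - θ([X, Y])`. -/
def extDerivOne (θ : OneForm I M) (X Y : VField I M) (x : M) : ℝ :=
  mvfderiv I (fun y ↦ θ y (Y y)) x (X x) - mvfderiv I (fun y ↦ θ y (X y)) x (Y x)
    - θ x (mlieBracket I X Y x)

/-- `dω(X, Y, Z) = X(ω(Y, Z)) - Y(ω(X, Z)) + Z(ω(X, Y)) - ω([X, Y], Z) + ω([X, Z], Y)
- ω([Y, Z], X)`. -/
def extDerivTwo (ω : Cov2 I M) (X Y Z : VField I M) (x : M) : ℝ :=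
  mvfderiv I (fun y ↦ ω y (Y y) (Z y)) x (X x)
    - mvfderiv I (fun y ↦ ω y (X y) (Z y)) x (Y x)
    + mvfderiv I (fun y ↦ ω y (X y) (Y y)) x (Z x)
    - ω x (mlieBracket I X Y x) (Z x)
    + ω x (mlieBracket I X Z x) (Y x)
    - ω x (mlieBracket I Y Z x) (X x)

/-- `(θ ∧ ω)(u, v, w) = θ(u) ω(v, w) + θ(v) ω(w, u) + θ(w) ω(u, v)`. -/
def wedgeOneTwo (θ : OneForm I M) (ω : Cov2 I M) (x : M) (u v w : TangentSpace I x) : ℝ :=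
  θ x u * ω x v w + θ x v * ω x w u + θ x w * ω x u v

/-- Locally conformally symplectic structures `(ω, θ)`: the `2`-form `ω` is nondegenerate, the
one-form `θ` is closed, and `dω + θ ∧ ω = 0`. -/
structure IsLCS [IsManifold I 1 M] (ω : Cov2 I M) (θ : OneForm I M) : Prop where
  twoForm : IsNondegenerateTwoForm ω
  smooth : SmoothOneForm θ
  closed : ∀ (x : M) (X Y : VField I M), MDiffAt (T% X) x → MDiffAt (T% Y) x →
    extDerivOne θ X Y x = 0
  conf : ∀ (x : M) (X Y Z : VField I M), MDiffAt (T% X) x → MDiffAt (T% Y) x →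
    MDiffAt (T% Z) x → extDerivTwo ω X Y Z x + wedgeOneTwo θ ω x (X x) (Y x) (Z x) = 0

theorem mdiffAt_apply [IsManifold I 1 M] {β : OneForm I M} {Z : VField I M} {x : M}
    (hβ : OneFormDiffAt β x) (hZ : MDiffAt (T% Z) x) : MDiffAt (fun y ↦ β y (Z y)) x := by
  have : MDifferentiableAt I (I.prod 𝓘(ℝ))
      (fun m ↦ TotalSpace.mk' ℝ (E := Bundle.Trivial M ℝ) m (β m (Z m))) x :=
    MDifferentiableAt.clm_bundle_apply (F₁ := E) hβ hZ
  rw [mdifferentiableAt_totalSpace] at this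
  exact this.2

section Calculus

variable [FiniteDimensional ℝ E]

section LieDerivative

variable [IsManifold I ((⊤ : ℕ∞) : WithTop ℕ∞) M]

/-- The value `(L_X β)(Z) = X(β(Z)) - β([X, Z])` at `x`. -/
def lieDerivEval (X : VField I M) (β : OneForm I M) (x : M) (Z : VField I M) : ℝ :=
  mvfderiv I (fun y ↦ β y (Z y)) x (X x) - β x (mlieBracket I X Z x)

theorem tensorialAt_lieDerivEval {X : VField I M} {β : OneForm I M} {x : M}
    (hβ : OneFormDiffAt β x) :
    TensorialAt I E (lieDerivEval X β x) x := by
  have : CompleteSpace E := FiniteDimensional.complete ℝ E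
  constructor
  · intro f Z hf hZ
    have h2 : (fun y ↦ β y ((f • Z) y)) = f * (fun y ↦ β y (Z y)) := by
      ext y; simp
    simp only [lieDerivEval]
    rw [h2, mlieBracket_smul_right hf hZ, mvfderiv_mul hf (mdiffAt_apply hβ hZ)]
    simp
    ring
  · intro Z Z' hZ hZ'
    have h2 : (fun y ↦ β y ((Z + Z') y)) = (fun y ↦ β y (Z y)) + (fun y ↦ β y (Z' y)) := by
      ext y; simp
    simp only [lieDerivEval]
    rw [h2, mlieBracket_add_right hZ hZ',
      mvfderiv_add (mdiffAt_apply hβ hZ) (mdiffAt_apply hβ hZ')]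
    simp
    ring

open Classical in
/-- The Lie derivative `L_X β` of a one-form: the one-form such that
`(L_X β)(Z) = X(β(Z)) - β([X, Z])`, see `lieDeriv_apply`. -/
def lieDeriv (X : VField I M) (β : OneForm I M) : OneForm I M := fun x ↦
  if h : TensorialAt I E (lieDerivEval X β x) x then h.mkHom (lieDerivEval X β x) x else 0

theorem lieDeriv_apply {X : VField I M} {β : OneForm I M} {Z : VField I M} {x : M}
    (hβ : OneFormDiffAt β x) (hZ : MDiffAt (T% Z) x) :
    lieDeriv X β x (Z x) = mvfderiv I (fun y ↦ β y (Z y)) x (X x) - β x (mlieBracket I X Z x) := by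
  rw [lieDeriv, dif_pos (tensorialAt_lieDerivEval hβ)]
  exact TensorialAt.mkHom_apply _ hZ

end LieDerivative

instance (x : M) : FiniteDimensional ℝ (TangentSpace I x) := inferInstanceAs (FiniteDimensional ℝ E)

instance (x : M) : T2Space (TangentSpace I x) := inferInstanceAs (T2Space E)

/-- The morphism `♯_P : T*M → TM` of a bivector field `P`, see `apply_sharpBi`. -/
def sharpBi (P : Contra2 I M) (x : M) (α : Cotangent I x) : TangentSpace I x :=
  (Module.evalEquiv ℝ (TangentSpace I x)).symm
    ((P x α : Cotangent I x →ₗ[ℝ] ℝ) ∘ₗ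
      (LinearMap.toContinuousLinearMap : (TangentSpace I x →ₗ[ℝ] ℝ) ≃ₗ[ℝ] _).toLinearMap)

theorem apply_sharpBi (P : Contra2 I M) (x : M) (α β : Cotangent I x) :
    β (sharpBi P x α) = P x α β := by
  have := Module.apply_evalEquiv_symm_apply ℝ (TangentSpace I x) (β : TangentSpace I x →ₗ[ℝ] ℝ)
    ((P x α : Cotangent I x →ₗ[ℝ] ℝ) ∘ₗ
      (LinearMap.toContinuousLinearMap : (TangentSpace I x →ₗ[ℝ] ℝ) ≃ₗ[ℝ] _).toLinearMap)
  exact this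

/-- The anchor `♯_{P,ξ}(α) = ♯_P(α) + α(ξ) ξ`. -/
def anchor (P : Contra2 I M) (ξ : VField I M) (x : M) (α : Cotangent I x) : TangentSpace I x :=
  sharpBi P x α + α (ξ x) • ξ x

section Bracket

variable [IsManifold I ((⊤ : ℕ∞) : WithTop ℕ∞) M]

/-- The Koszul bracket `[α, β]_P = L_{♯_P α} β - L_{♯_P β} α - d(P(α, β))`. -/
def koszulBracket (P : Contra2 I M) (α β : OneForm I M) : OneForm I M := fun x ↦
  lieDeriv (fun y ↦ sharpBi P y (α y)) β x - lieDeriv (fun y ↦ sharpBi P y (β y)) α x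
    - mvfderiv I (fun y ↦ P y (α y) (β y)) x

/-- The bracket `[α, β]_{P,ξ}^λ`. -/
def jacobiBracket (P : Contra2 I M) (ξ : VField I M) (lam : OneForm I M) (α β : OneForm I M) :
    OneForm I M := fun x ↦
  koszulBracket P α β x + α x (ξ x) • (lieDeriv ξ β x - β x) - β x (ξ x) • (lieDeriv ξ α x - α x)
    - P x (α x) (β x) • lam x

end Bracket

end Calculus

/-! ### Musical isomorphisms and metrics -/

theorem isInvertible_of_nondegenerate [FiniteDimensional ℝ E] {x : M}
    (b : TangentSpace I x →L[ℝ] TangentSpace I x →L[ℝ] ℝ)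
    (hb : ∀ v, (∀ w, b v w = 0) → v = 0) : b.IsInvertible := by
  let b' : E →L[ℝ] E →L[ℝ] ℝ := b
  have hinj : Function.Injective b'.toLinearMap := by
    rw [← LinearMap.ker_eq_bot, LinearMap.ker_eq_bot']
    intro v hv
    exact hb v fun w ↦ congrArg (fun f : E →L[ℝ] ℝ ↦ f w) hv
  have hfr : Module.finrank ℝ E = Module.finrank ℝ (E →L[ℝ] ℝ) := by
    rw [← (LinearMap.toContinuousLinearMap : (E →ₗ[ℝ] ℝ) ≃ₗ[ℝ] (E →L[ℝ] ℝ)).finrank_eq]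
    exact (Subspace.dual_finrank_eq (K := ℝ) (V := E)).symm
  let e := (LinearEquiv.ofInjectiveOfFinrankEq b'.toLinearMap hinj hfr).toContinuousLinearEquiv
  refine ⟨e, ?_⟩
  ext v w
  rfl

/-- `♯_g`, the inverse of `♭_g : v ↦ g(v, ·)`. -/
def sharpMetric (g : Cov2 I M) (x : M) : Cotangent I x →L[ℝ] TangentSpace I x :=
  (g x).inverse

theorem metric_sharpMetric [FiniteDimensional ℝ E] [IsManifold I 1 M] {g : Cov2 I M}
    (h : IsPseudoRiemannianMetric g) (x : M) (α : Cotangent I x) (v : TangentSpace I x) :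
    g x (sharpMetric g x α) v = α v := by
  have hi : (g x).IsInvertible := isInvertible_of_nondegenerate _ (h.nondegenerate x)
  exact congrArg (fun f : Cotangent I x ↦ f v) (hi.self_apply_inverse α)

/-- The cometric `g*(α, β) = g(♯_g α, ♯_g β)`. -/
def cometric (g : Cov2 I M) (x : M) (α β : Cotangent I x) : ℝ :=
  g x (sharpMetric g x α) (sharpMetric g x β)

/-- The endomorphism `J` with `g(J v, w) = P(♭_g v, ♭_g w)`, that is
`g(J ♯_g α, ♯_g β) = P(α, β)`. -/
def endoJ (P : Contra2 I M) (g : Cov2 I M) (x : M) (v : TangentSpace I x) : TangentSpace I x :=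
  sharpMetric g x ((P x (g x v)).comp (g x))

/-- The one-form `λ = g(ξ, ξ) ♭_g(ξ) - ♭_g(J ξ)`. -/
def lambdaForm (P : Contra2 I M) (ξ : VField I M) (g : Cov2 I M) : OneForm I M := fun x ↦
  g x (ξ x) (ξ x) • g x (ξ x) - g x (endoJ P g x (ξ x))

/-! ### Contravariant and covariant derivatives -/

section Derivatives

variable [FiniteDimensional ℝ E] [IsManifold I ((⊤ : ℕ∞) : WithTop ℕ∞) M]

/-- `D` is a contravariant Levi-Civita derivative of the triple `(P, ξ, g)`. Here `D β x a` is the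
value at `x` of `D_α β` for any one-form `α` with `α x = a`. The first two conditions say that `D`
is a contravariant derivative with anchor `♯_{P,ξ}`, the third one that it is symmetric for the
bracket `[·, ·]_{P,ξ}^g = [·, ·]_{P,ξ}^λ`, the last one that it is compatible with `g*`. -/
structure IsContravariantLeviCivita (P : Contra2 I M) (ξ : VField I M) (g : Cov2 I M)
    (D : OneForm I M → Π x : M, Cotangent I x →L[ℝ] Cotangent I x) : Prop where
  add : ∀ (x : M) (β β' : OneForm I M), OneFormDiffAt β x → OneFormDiffAt β' x →
    D (β + β') x = D β x + D β' x
  leibniz : ∀ (x : M) (f : M → ℝ) (β : OneForm I M) (a : Cotangent I x), MDiffAt f x →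
    OneFormDiffAt β x →
    D (fun y ↦ f y • β y) x a = f x • D β x a + mvfderiv I f x (anchor P ξ x a) • β x
  symm : ∀ (x : M) (α β : OneForm I M), OneFormDiffAt α x → OneFormDiffAt β x →
    D β x (α x) - D α x (β x) = jacobiBracket P ξ (lambdaForm P ξ g) α β x
  metric : ∀ (x : M) (a : Cotangent I x) (β γ : OneForm I M), OneFormDiffAt β x →
    OneFormDiffAt γ x →
    mvfderiv I (fun y ↦ cometric g y (β y) (γ y)) x (anchor P ξ x a)
      = cometric g x (D β x a) (γ x) + cometric g x (β x) (D γ x a)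

/-- `nabla` is a Levi-Civita connection of `g`: it is torsion-free and compatible with `g`.
Here `nabla Y x v` is `∇_v Y`. -/
structure IsLeviCivita (g : Cov2 I M)
    (nabla : CovariantDerivative I E (TangentSpace I : M → Type _)) : Prop where
  torsion : ∀ (x : M) (X Y : VField I M), MDiffAt (T% X) x → MDiffAt (T% Y) x →
    nabla Y x (X x) - nabla X x (Y x) = mlieBracket I X Y x
  metric : ∀ (x : M) (v : TangentSpace I x) (Y Z : VField I M), MDiffAt (T% Y) x →
    MDiffAt (T% Z) x →
    mvfderiv I (fun y ↦ g y (Y y) (Z y)) x v = g x (nabla Y x v) (Z x) + g x (Y x) (nabla Z x v)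

/-- `(DP)(α, β, γ) = ♯_{P,ξ}(α)(P(β, γ)) - P(D_α β, γ) - P(β, D_α γ)`. -/
def contraDerivBi (P : Contra2 I M) (ξ : VField I M)
    (D : OneForm I M → Π x : M, Cotangent I x →L[ℝ] Cotangent I x)
    (α β γ : OneForm I M) (x : M) : ℝ :=
  mvfderiv I (fun y ↦ P y (β y) (γ y)) x (anchor P ξ x (α x))
    - P x (D β x (α x)) (γ x) - P x (β x) (D γ x (α x))

/-- `(∇ω)(X, Y, Z) = X(ω(Y, Z)) - ω(∇_X Y, Z) - ω(Y, ∇_X Z)`. -/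
def covDerivTwo (ω : Cov2 I M) (nabla : CovariantDerivative I E (TangentSpace I : M → Type _))
    (X Y Z : VField I M) (x : M) : ℝ :=
  mvfderiv I (fun y ↦ ω y (Y y) (Z y)) x (X x)
    - ω x (nabla Y x (X x)) (Z x) - ω x (Y x) (nabla Z x (X x))

end Derivatives

/-! ### The pair `(P, ξ)` associated with `(ω, θ)` -/

/-- `♯_ω`, the inverse of `♭_ω : v ↦ -ω(v, ·)`. -/
def sharpForm (ω : Cov2 I M) (x : M) : Cotangent I x →L[ℝ] TangentSpace I x :=
  (-(ω x)).inverse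

theorem form_sharpForm [FiniteDimensional ℝ E] [IsManifold I 1 M] {ω : Cov2 I M}
    (h : IsNondegenerateTwoForm ω) (x : M) (α : Cotangent I x) (v : TangentSpace I x) :
    ω x (sharpForm ω x α) v = - α v := by
  have hi : (-(ω x)).IsInvertible := isInvertible_of_nondegenerate _ fun v hv ↦
    h.nondegenerate x v fun w ↦ by simpa using hv w
  have := congrArg (fun f : Cotangent I x ↦ f v) (hi.self_apply_inverse α)
  simp at this
  rw [← this]; simp [sharpForm]

/-- The bivector field `P(α, β) = ω(♯_ω α, ♯_ω β)`. -/
def assocBi (ω : Cov2 I M) : Contra2 I M := fun x ↦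
  ((sharpForm ω x).precomp ℝ).comp ((ω x).comp (sharpForm ω x))

/-- The vector field `ξ = ♯_ω θ`. -/
def assocVField (ω : Cov2 I M) (θ : OneForm I M) : VField I M := fun x ↦ sharpForm ω x (θ x)

/-- `♯_{ω,θ} = ♯_{P,ξ}`. -/
def sharpLCS [FiniteDimensional ℝ E] (ω : Cov2 I M) (θ : OneForm I M) (x : M)
    (α : Cotangent I x) : TangentSpace I x :=
  anchor (assocBi ω) (assocVField ω θ) x α

/-- The metric `g` is associated with `(ω, θ)`: `♯_{ω,θ}` is an isometry from `g*` to `g`. -/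
def IsAssociatedMetric [FiniteDimensional ℝ E] (ω : Cov2 I M) (θ : OneForm I M) (g : Cov2 I M) :
    Prop :=
  ∀ (x : M) (α β : Cotangent I x),
    g x (sharpLCS ω θ x α) (sharpLCS ω θ x β) = cometric g x α β

end

end LCS

namespace LCS

open Filter Topology FiberBundle ContinuousLinearMap

/-! ### Inverses of bundle isomorphisms -/

section Inverse

variable {EB : Type*} [NormedAddCommGroup EB] [NormedSpace ℝ EB]
  {HB : Type*} [TopologicalSpace HB] {IB : ModelWithCorners ℝ EB HB}
  {B : Type*} [TopologicalSpace B] [ChartedSpace HB B]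
  {F₁ : Type*} [NormedAddCommGroup F₁] [NormedSpace ℝ F₁] [CompleteSpace F₁]
  {F₂ : Type*} [NormedAddCommGroup F₂] [NormedSpace ℝ F₂]
  {V₁ : B → Type*} [TopologicalSpace (TotalSpace F₁ V₁)] [∀ x, AddCommGroup (V₁ x)]
  [∀ x, Module ℝ (V₁ x)] [∀ x, TopologicalSpace (V₁ x)]
  [FiberBundle F₁ V₁] [VectorBundle ℝ F₁ V₁]
  {V₂ : B → Type*} [TopologicalSpace (TotalSpace F₂ V₂)] [∀ x, AddCommGroup (V₂ x)]
  [∀ x, Module ℝ (V₂ x)] [∀ x, TopologicalSpace (V₂ x)]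
  [∀ x, IsTopologicalAddGroup (V₂ x)] [∀ x, ContinuousSMul ℝ (V₂ x)]
  [FiberBundle F₂ V₂] [VectorBundle ℝ F₂ V₂]

/-- Applying the inverses of a differentiable family of isomorphisms to a differentiable section
gives a differentiable section. -/
theorem mdifferentiableAt_inverse_apply {φ : ∀ y, V₁ y →L[ℝ] V₂ y} {v : ∀ y, V₂ y} {x : B}
    (hφ : MDifferentiableAt IB (IB.prod 𝓘(ℝ, F₁ →L[ℝ] F₂))
      (fun y ↦ TotalSpace.mk' (F₁ →L[ℝ] F₂) (E := fun y ↦ V₁ y →L[ℝ] V₂ y) y (φ y)) x)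
    (hi : ∀ y, (φ y).IsInvertible)
    (hv : MDifferentiableAt IB (IB.prod 𝓘(ℝ, F₂)) (fun y ↦ TotalSpace.mk' F₂ y (v y)) x) :
    MDifferentiableAt IB (IB.prod 𝓘(ℝ, F₁))
      (fun y ↦ TotalSpace.mk' F₁ y ((φ y).inverse (v y))) x := by
  rw [mdifferentiableAt_hom_bundle] at hφ
  have h2 := hφ.2
  simp only at h2
  refine MDifferentiableAt.clm_apply_of_inCoordinates (F₁ := F₂) (E₁ := V₂) (b₁ := fun y ↦ y)
    (b₂ := fun y ↦ y) (ϕ := fun y ↦ (φ y).inverse) ?_ hv mdifferentiableAt_id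
  have hx1 := mem_baseSet_trivializationAt F₁ V₁ x
  have hx2 := mem_baseSet_trivializationAt F₂ V₂ x
  have hinv : (inCoordinates F₁ V₁ F₂ V₂ x x x x (φ x)).IsInvertible := by
    rw [inCoordinates_eq hx1 hx2]
    obtain ⟨e, he⟩ := hi x
    rw [← he]
    exact ContinuousLinearMap.isInvertible_equiv.comp
      (ContinuousLinearMap.isInvertible_equiv.comp ContinuousLinearMap.isInvertible_equiv)
  have h3 : DifferentiableAt ℝ (ContinuousLinearMap.inverse : (F₁ →L[ℝ] F₂) → (F₂ →L[ℝ] F₁))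
      (inCoordinates F₁ V₁ F₂ V₂ x x x x (φ x)) :=
    (hinv.contDiffAt_map_inverse (n := 1)).differentiableAt one_ne_zero
  refine (DifferentiableAt.comp_mdifferentiableAt
    (f := fun y ↦ inCoordinates F₁ V₁ F₂ V₂ x y x y (φ y)) h3 h2).congr_of_eventuallyEq ?_
  filter_upwards [(trivializationAt F₁ V₁ x).open_baseSet.mem_nhds hx1,
    (trivializationAt F₂ V₂ x).open_baseSet.mem_nhds hx2] with y hy1 hy2
  obtain ⟨e, he⟩ := hi y
  simp only [Function.comp]
  rw [inCoordinates_eq hy2 hy1, inCoordinates_eq hy1 hy2, ← he]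
  simp
  rfl

end Inverse

variable {E : Type*} [NormedAddCommGroup E] [NormedSpace ℝ E]
  {H : Type*} [TopologicalSpace H] {I : ModelWithCorners ℝ E H}
  {M : Type*} [TopologicalSpace M] [ChartedSpace H M]

/-! ### Differentiability of pairings -/

section Differentiability

variable [IsManifold I 1 M]

theorem SmoothCov2.mdifferentiableAt {b : Cov2 I M} (hb : SmoothCov2 b) (x : M) :
    MDifferentiableAt I (I.prod 𝓘(ℝ, E →L[ℝ] E →L[ℝ] ℝ))
      (fun y ↦ TotalSpace.mk' (E →L[ℝ] E →L[ℝ] ℝ) y (b y)) x :=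
  (hb x).mdifferentiableAt (by simp)

theorem SmoothOneForm.oneFormDiffAt {α : OneForm I M} (hα : SmoothOneForm α) (x : M) :
    OneFormDiffAt α x :=
  (hα x).mdifferentiableAt (by simp)

theorem SmoothCov2.oneFormDiffAt {b : Cov2 I M} (hb : SmoothCov2 b) {X : VField I M} {x : M}
    (hX : MDiffAt (T% X) x) : OneFormDiffAt (fun y ↦ b y (X y)) x :=
  MDifferentiableAt.clm_bundle_apply (F₁ := E) (hb.mdifferentiableAt x) hX

theorem SmoothCov2.mdiffAt_apply {b : Cov2 I M} (hb : SmoothCov2 b) {X Y : VField I M} {x : M}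
    (hX : MDiffAt (T% X) x) (hY : MDiffAt (T% Y) x) : MDiffAt (fun y ↦ b y (X y) (Y y)) x :=
  LCS.mdiffAt_apply (hb.oneFormDiffAt hX) hY

theorem exists_vField_eq (x : M) (v : TangentSpace I x) :
    ∃ X : VField I M, MDiffAt (T% X) x ∧ X x = v :=
  ⟨extend E v, mdifferentiableAt_extend .., by simp⟩

theorem exists_oneForm_eq (x : M) (a : Cotangent I x) :
    ∃ α : OneForm I M, OneFormDiffAt α x ∧ α x = a :=
  ⟨FiberBundle.extend (E →L[ℝ] ℝ) a,
    mdifferentiableAt_extend (V := fun x : M ↦ Cotangent I x) I (E →L[ℝ] ℝ) a, by simp⟩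

variable [FiniteDimensional ℝ E]

theorem IsNondegenerateTwoForm.mdiffAt_sharpForm {ω : Cov2 I M}
    (hω : IsNondegenerateTwoForm ω) {α : OneForm I M} {x : M} (hα : OneFormDiffAt α x) :
    MDiffAt (T% (fun y ↦ sharpForm ω y (α y))) x := by
  have : CompleteSpace E := FiniteDimensional.complete ℝ E
  refine mdifferentiableAt_inverse_apply (mdifferentiableAt_neg_section
    (hω.smooth.mdifferentiableAt x)) (fun y ↦ isInvertible_of_nondegenerate _ fun v hv ↦
      hω.nondegenerate y v fun w ↦ ?_) hα
  simpa using hv w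

end Differentiability

/-! ### Pointwise identities -/

section Pointwise

variable {ω g : Cov2 I M} {θ : OneForm I M}

theorem assocBi_apply (x : M) (a b : Cotangent I x) :
    assocBi ω x a b = ω x (sharpForm ω x a) (sharpForm ω x b) := rfl

section

variable [IsManifold I 1 M]

theorem IsNondegenerateTwoForm.antisymm (hω : IsNondegenerateTwoForm ω) (x : M)
    (v w : TangentSpace I x) : ω x v w = - ω x w v := by
  have h := hω.alt x (v + w)
  simp only [map_add, add_apply, hω.alt] at h
  linarith

theorem cometric_symm (hg : IsPseudoRiemannianMetric g) (x : M) (a b : Cotangent I x) :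
    cometric g x a b = cometric g x b a :=
  hg.symm x _ _

theorem assocBi_antisymm (hω : IsNondegenerateTwoForm ω) (x : M) (a b : Cotangent I x) :
    assocBi ω x a b = - assocBi ω x b a :=
  hω.antisymm x _ _

end

theorem eq_of_forall_cotangent {x : M} {v w : TangentSpace I x}
    (h : ∀ a : Cotangent I x, a v = a w) : v = w := by
  have : SeparatingDual ℝ (TangentSpace I x) := inferInstanceAs (SeparatingDual ℝ E)
  exact (SeparatingDual.eq_iff_forall_dual_eq (R := ℝ)).2 h

variable [FiniteDimensional ℝ E] [IsManifold I 1 M]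

theorem assocBi_eq (hω : IsNondegenerateTwoForm ω) (x : M) (a b : Cotangent I x) :
    assocBi ω x a b = b (sharpForm ω x a) := by
  rw [assocBi_apply, hω.antisymm, form_sharpForm hω, neg_neg]

theorem sharpBi_assocBi (hω : IsNondegenerateTwoForm ω) (x : M) (a : Cotangent I x) :
    sharpBi (assocBi ω) x a = sharpForm ω x a :=
  eq_of_forall_cotangent fun b ↦ by rw [apply_sharpBi, assocBi_eq hω]

theorem sharpLCS_eq (hω : IsNondegenerateTwoForm ω) (x : M) (a : Cotangent I x) :
    sharpLCS ω θ x a = sharpForm ω x a + a (assocVField ω θ x) • assocVField ω θ x := by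
  rw [sharpLCS, anchor, sharpBi_assocBi hω]

theorem form_sharpLCS (hω : IsNondegenerateTwoForm ω) (x : M) (a b : Cotangent I x) :
    ω x (sharpLCS ω θ x a) (sharpLCS ω θ x b) = assocBi ω x a b := by
  have h1 := form_sharpForm hω x a (assocVField ω θ x)
  have h2 := form_sharpForm hω x b (assocVField ω θ x)
  rw [hω.antisymm] at h2
  rw [sharpLCS_eq hω, sharpLCS_eq hω, assocBi_apply]
  simp only [map_add, map_smul, add_apply, smul_apply, smul_eq_mul, hω.alt, h1]
  linear_combination - a (assocVField ω θ x) * h2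

theorem sharpLCS_theta (hω : IsNondegenerateTwoForm ω) (x : M) :
    sharpLCS ω θ x (θ x) = assocVField ω θ x := by
  have h : θ x (assocVField ω θ x) = 0 := by
    rw [assocVField, ← assocBi_eq hω]; exact hω.alt x _
  rw [sharpLCS_eq hω, h, zero_smul, add_zero]; rfl

theorem cometric_eq (hg : IsPseudoRiemannianMetric g) (x : M) (a b : Cotangent I x) :
    cometric g x a b = a (sharpMetric g x b) :=
  metric_sharpMetric hg x a _

theorem cometric_metric (hg : IsPseudoRiemannianMetric g) (x : M) (v : TangentSpace I x)
    (b : Cotangent I x) : cometric g x (g x v) b = b v := by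
  rw [cometric_eq hg, hg.symm, metric_sharpMetric hg]

theorem eq_of_cometric_eq (hg : IsPseudoRiemannianMetric g) {x : M} {a b : Cotangent I x}
    (h : ∀ c, cometric g x a c = cometric g x b c) : a = b := by
  ext v
  rw [← cometric_metric hg, ← cometric_metric hg x v b, cometric_symm hg, h, cometric_symm hg]

theorem metric_sharpMetric_eq (hg : IsPseudoRiemannianMetric g) (x : M) (a : Cotangent I x) :
    g x (sharpMetric g x a) = a :=
  ContinuousLinearMap.ext (metric_sharpMetric hg x a)

theorem lambdaForm_eq (hω : IsNondegenerateTwoForm ω) (hg : IsPseudoRiemannianMetric g)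
    (hass : IsAssociatedMetric ω θ g) :
    lambdaForm (assocBi ω) (assocVField ω θ) g = θ := by
  funext x
  refine eq_of_cometric_eq hg fun c ↦ ?_
  rw [← hass x (θ x), sharpLCS_theta hω, sharpLCS_eq hω, cometric_eq hg]
  have h := assocBi_antisymm hω x c (g x (assocVField ω θ x))
  rw [assocBi_eq hω x c] at h
  simp only [lambdaForm, endoJ, sub_apply, smul_apply, smul_eq_mul, map_add, map_smul,
    metric_sharpMetric_eq hg, comp_apply, h]
  rw [← cometric_eq hg, cometric_metric hg]
  ring

end Pointwise

end LCS

namespace LCS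

variable {E : Type*} [NormedAddCommGroup E] [NormedSpace ℝ E]
  {H : Type*} [TopologicalSpace H] {I : ModelWithCorners ℝ E H}
  {M : Type*} [TopologicalSpace M] [ChartedSpace H M]

/-! ### The Levi-Civita connection -/

section LeviCivita

/-- The right-hand side `2 g(∇_X Y, Z)` of the Koszul formula. -/
noncomputable def koszulForm (g : Cov2 I M) (X Y Z : VField I M) (x : M) : ℝ :=
  mvfderiv I (fun y ↦ g y (Y y) (Z y)) x (X x) + mvfderiv I (fun y ↦ g y (X y) (Z y)) x (Y x)
    - mvfderiv I (fun y ↦ g y (X y) (Y y)) x (Z x) + g x (mlieBracket I X Y x) (Z x)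
    - g x (mlieBracket I X Z x) (Y x) - g x (mlieBracket I Y Z x) (X x)

theorem apply_smul_left (g : Cov2 I M) (f : M → ℝ) (X Y : VField I M) :
    (fun y ↦ g y ((f • X) y) (Y y)) = f * fun y ↦ g y (X y) (Y y) := by
  ext y; simp

theorem apply_smul_right (g : Cov2 I M) (f : M → ℝ) (X Y : VField I M) :
    (fun y ↦ g y (X y) ((f • Y) y)) = f * fun y ↦ g y (X y) (Y y) := by
  ext y; simp

theorem apply_add_left (g : Cov2 I M) (X X' Y : VField I M) :
    (fun y ↦ g y ((X + X') y) (Y y)) = (fun y ↦ g y (X y) (Y y)) + fun y ↦ g y (X' y) (Y y) := by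
  ext y; simp

theorem apply_add_right (g : Cov2 I M) (X Y Y' : VField I M) :
    (fun y ↦ g y (X y) ((Y + Y') y)) = (fun y ↦ g y (X y) (Y y)) + fun y ↦ g y (X y) (Y' y) := by
  ext y; simp

theorem eq_of_metric_eq [IsManifold I 1 M] {g : Cov2 I M}
    (hg : IsPseudoRiemannianMetric g) {x : M}
    {v w : TangentSpace I x}
    (h : ∀ Z : VField I M, MDiffAt (T% Z) x → g x v (Z x) = g x w (Z x)) : v = w := by
  rw [← sub_eq_zero]
  refine hg.nondegenerate x _ fun u ↦ ?_
  obtain ⟨Z, hZ, rfl⟩ := exists_vField_eq x u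
  simp [h Z hZ]

variable [FiniteDimensional ℝ E] [IsManifold I ((⊤ : ℕ∞) : WithTop ℕ∞) M]
  {g : Cov2 I M} {x : M} {X Y Z : VField I M}

theorem koszulForm_smul_left (hg : IsPseudoRiemannianMetric g) {f : M → ℝ} (hf : MDiffAt f x)
    (hX : MDiffAt (T% X) x) (hY : MDiffAt (T% Y) x) (hZ : MDiffAt (T% Z) x) :
    koszulForm g (f • X) Y Z x = f x * koszulForm g X Y Z x := by
  have : CompleteSpace E := FiniteDimensional.complete ℝ E
  have h := hg.symm x (X x) (Y x)
  have h' := hg.symm x (X x) (Z x)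
  simp only [koszulForm, apply_smul_left]
  rw [mvfderiv_mul hf (hg.smooth.mdiffAt_apply hX hZ),
    mvfderiv_mul hf (hg.smooth.mdiffAt_apply hX hY), mlieBracket_smul_left hf hX,
    mlieBracket_smul_left hf hX]
  simp [h, h']
  ring

theorem koszulForm_smul_right (hg : IsPseudoRiemannianMetric g) {f : M → ℝ} (hf : MDiffAt f x)
    (hX : MDiffAt (T% X) x) (hY : MDiffAt (T% Y) x) (hZ : MDiffAt (T% Z) x) :
    koszulForm g X Y (f • Z) x = f x * koszulForm g X Y Z x := by
  have : CompleteSpace E := FiniteDimensional.complete ℝ E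
  have h := hg.symm x (Z x) (Y x)
  have h' := hg.symm x (Z x) (X x)
  simp only [koszulForm, apply_smul_right]
  rw [mvfderiv_mul hf (hg.smooth.mdiffAt_apply hX hZ),
    mvfderiv_mul hf (hg.smooth.mdiffAt_apply hY hZ), mlieBracket_smul_right hf hZ,
    mlieBracket_smul_right hf hZ]
  simp [h, h']
  ring

theorem koszulForm_smul_mid (hg : IsPseudoRiemannianMetric g) {f : M → ℝ} (hf : MDiffAt f x)
    (hX : MDiffAt (T% X) x) (hY : MDiffAt (T% Y) x) (hZ : MDiffAt (T% Z) x) :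
    koszulForm g X (f • Y) Z x =
      f x * koszulForm g X Y Z x + 2 * (mvfderiv I f x (X x) * g x (Y x) (Z x)) := by
  have : CompleteSpace E := FiniteDimensional.complete ℝ E
  have h := hg.symm x (X x) (Y x)
  simp only [koszulForm, apply_smul_right, apply_smul_left]
  rw [mvfderiv_mul hf (hg.smooth.mdiffAt_apply hY hZ),
    mvfderiv_mul hf (hg.smooth.mdiffAt_apply hX hY), mlieBracket_smul_right hf hY,
    mlieBracket_smul_left hf hY]
  simp [h]
  ring

theorem koszulForm_add_left (hg : IsPseudoRiemannianMetric g) {X' : VField I M}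
    (hX : MDiffAt (T% X) x) (hX' : MDiffAt (T% X') x) (hY : MDiffAt (T% Y) x)
    (hZ : MDiffAt (T% Z) x) :
    koszulForm g (X + X') Y Z x = koszulForm g X Y Z x + koszulForm g X' Y Z x := by
  have : CompleteSpace E := FiniteDimensional.complete ℝ E
  simp only [koszulForm, apply_add_left]
  rw [mvfderiv_add (hg.smooth.mdiffAt_apply hX hZ) (hg.smooth.mdiffAt_apply hX' hZ),
    mvfderiv_add (hg.smooth.mdiffAt_apply hX hY) (hg.smooth.mdiffAt_apply hX' hY),
    mlieBracket_add_left hX hX', mlieBracket_add_left hX hX']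
  simp
  ring

theorem koszulForm_add_right (hg : IsPseudoRiemannianMetric g) {Z' : VField I M}
    (hX : MDiffAt (T% X) x) (hY : MDiffAt (T% Y) x) (hZ : MDiffAt (T% Z) x)
    (hZ' : MDiffAt (T% Z') x) :
    koszulForm g X Y (Z + Z') x = koszulForm g X Y Z x + koszulForm g X Y Z' x := by
  have : CompleteSpace E := FiniteDimensional.complete ℝ E
  simp only [koszulForm, apply_add_right]
  rw [mvfderiv_add (hg.smooth.mdiffAt_apply hX hZ) (hg.smooth.mdiffAt_apply hX hZ'),
    mvfderiv_add (hg.smooth.mdiffAt_apply hY hZ) (hg.smooth.mdiffAt_apply hY hZ'),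
    mlieBracket_add_right hZ hZ', mlieBracket_add_right hZ hZ']
  simp
  ring

theorem koszulForm_add_mid (hg : IsPseudoRiemannianMetric g) {Y' : VField I M}
    (hX : MDiffAt (T% X) x) (hY : MDiffAt (T% Y) x) (hY' : MDiffAt (T% Y') x)
    (hZ : MDiffAt (T% Z) x) :
    koszulForm g X (Y + Y') Z x = koszulForm g X Y Z x + koszulForm g X Y' Z x := by
  have : CompleteSpace E := FiniteDimensional.complete ℝ E
  simp only [koszulForm, apply_add_left, apply_add_right]
  rw [mvfderiv_add (hg.smooth.mdiffAt_apply hY hZ) (hg.smooth.mdiffAt_apply hY' hZ),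
    mvfderiv_add (hg.smooth.mdiffAt_apply hX hY) (hg.smooth.mdiffAt_apply hX hY'),
    mlieBracket_add_right hY hY', mlieBracket_add_left hY hY']
  simp
  ring

theorem tensorialAt_koszulForm_left (hg : IsPseudoRiemannianMetric g) (hY : MDiffAt (T% Y) x)
    (hZ : MDiffAt (T% Z) x) : TensorialAt I E (fun X ↦ koszulForm g X Y Z x) x where
  smul hf hX := koszulForm_smul_left hg hf hX hY hZ
  add hX hX' := koszulForm_add_left hg hX hX' hY hZ

theorem tensorialAt_koszulForm_right (hg : IsPseudoRiemannianMetric g) (hX : MDiffAt (T% X) x)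
    (hY : MDiffAt (T% Y) x) : TensorialAt I E (fun Z ↦ koszulForm g X Y Z x) x where
  smul hf hZ := koszulForm_smul_right hg hf hX hY hZ
  add hZ hZ' := koszulForm_add_right hg hX hY hZ hZ'

open Classical in
/-- The derivative `∇ Y` at `x` determined by the Koszul formula. -/
noncomputable def leviCivitaAux (g : Cov2 I M) (hg : IsPseudoRiemannianMetric g) (Y : VField I M)
    (x : M) : TangentSpace I x →L[ℝ] TangentSpace I x :=
  if hY : MDiffAt (T% Y) x then
    (sharpMetric g x).comp ((2⁻¹ : ℝ) • TensorialAt.mkHom₂ (I := I) (F := E) (F' := E)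
      (fun X Z ↦ koszulForm g X Y Z x) x
      (fun _ hZ ↦ tensorialAt_koszulForm_left hg hY hZ)
      (fun _ hX ↦ tensorialAt_koszulForm_right hg hX hY))
  else 0

theorem metric_leviCivitaAux (hg : IsPseudoRiemannianMetric g) (hX : MDiffAt (T% X) x)
    (hY : MDiffAt (T% Y) x) (hZ : MDiffAt (T% Z) x) :
    g x (leviCivitaAux g hg Y x (X x)) (Z x) = 2⁻¹ * koszulForm g X Y Z x := by
  rw [leviCivitaAux, dif_pos hY, ContinuousLinearMap.comp_apply, metric_sharpMetric hg]
  simp only [smul_apply, smul_eq_mul]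
  rw [TensorialAt.mkHom₂_apply _ _ hX hZ]

/-- A pseudo-Riemannian metric has a Levi-Civita connection. -/
theorem exists_isLeviCivita (hg : IsPseudoRiemannianMetric g) :
    ∃ nabla, IsLeviCivita g nabla := by
  refine ⟨⟨leviCivitaAux g hg, ?_, ?_⟩, ?_, ?_⟩
  · intro Y Y' x hY hY' _
    ext v
    obtain ⟨X, hX, rfl⟩ := exists_vField_eq x v
    refine eq_of_metric_eq hg fun Z hZ ↦ ?_
    rw [metric_leviCivitaAux hg hX (mdifferentiableAt_add_section hY hY') hZ,
      koszulForm_add_mid hg hX hY hY' hZ]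
    simp [metric_leviCivitaAux hg hX hY hZ, metric_leviCivitaAux hg hX hY' hZ]
    ring
  · intro Y f x hY hf _
    ext v
    obtain ⟨X, hX, rfl⟩ := exists_vField_eq x v
    refine eq_of_metric_eq hg fun Z hZ ↦ ?_
    rw [metric_leviCivitaAux hg hX (hf.smul_section hY) hZ, koszulForm_smul_mid hg hf hX hY hZ]
    simp [metric_leviCivitaAux hg hX hY hZ]
    ring
  · intro x X Y hX hY
    refine eq_of_metric_eq hg fun Z hZ ↦ ?_
    simp only [map_sub, sub_apply]
    rw [metric_leviCivitaAux hg hX hY hZ, metric_leviCivitaAux hg hY hX hZ, koszulForm, koszulForm,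
      mlieBracket_swap_apply (V := Y) (W := X)]
    simp only [hg.symm _ (Y _) (X _), map_neg, neg_apply]
    ring
  · intro x v Y Z hY hZ
    obtain ⟨X, hX, rfl⟩ := exists_vField_eq x v
    rw [hg.symm x (Y x)]
    change _ = g x (leviCivitaAux g hg Y x (X x)) (Z x) + g x (leviCivitaAux g hg Z x (X x)) (Y x)
    rw [metric_leviCivitaAux hg hX hY hZ, metric_leviCivitaAux hg hX hZ hY, koszulForm, koszulForm,
      mlieBracket_swap_apply (V := Z) (W := Y)]
    simp only [hg.symm _ (Z _) (Y _), map_neg, neg_apply]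
    ring

end LeviCivita

end LCS

namespace LCS

variable {E : Type*} [NormedAddCommGroup E] [NormedSpace ℝ E]
  {H : Type*} [TopologicalSpace H] {I : ModelWithCorners ℝ E H}
  {M : Type*} [TopologicalSpace M] [ChartedSpace H M]

/-! ### The bracket of one-forms and the Lie bracket -/

section Bracket

theorem eq_of_form_eq [IsManifold I 1 M] {ω : Cov2 I M} {x : M}
    (hω : IsNondegenerateTwoForm ω) {v w : TangentSpace I x}
    (h : ∀ Z : VField I M, MDiffAt (T% Z) x → ω x v (Z x) = ω x w (Z x)) : v = w := by
  rw [← sub_eq_zero]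
  refine hω.nondegenerate x _ fun u ↦ ?_
  obtain ⟨Z, hZ, rfl⟩ := exists_vField_eq x u
  simp [h Z hZ]

variable [FiniteDimensional ℝ E] [IsManifold I ((⊤ : ℕ∞) : WithTop ℕ∞) M]
  {ω : Cov2 I M} {θ : OneForm I M} {α β : OneForm I M} {Z : VField I M} {x : M}

theorem koszulBracket_apply (hω : IsNondegenerateTwoForm ω) (hα : OneFormDiffAt α x)
    (hβ : OneFormDiffAt β x) (hZ : MDiffAt (T% Z) x) :
    koszulBracket (assocBi ω) α β x (Z x) =
      mvfderiv I (fun y ↦ β y (Z y)) x (sharpForm ω x (α x))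
        - β x (mlieBracket I (fun y ↦ sharpForm ω y (α y)) Z x)
        - (mvfderiv I (fun y ↦ α y (Z y)) x (sharpForm ω x (β x))
          - α x (mlieBracket I (fun y ↦ sharpForm ω y (β y)) Z x))
        - mvfderiv I (fun y ↦ assocBi ω y (α y) (β y)) x (Z x) := by
  simp only [koszulBracket, sub_apply, sharpBi_assocBi hω]
  rw [lieDeriv_apply hβ hZ, lieDeriv_apply hα hZ]

theorem theta_sharpForm (hω : IsNondegenerateTwoForm ω) (a : Cotangent I x) :
    θ x (sharpForm ω x a) = - a (assocVField ω θ x) := by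
  rw [← assocBi_eq hω, assocBi_antisymm hω, assocBi_eq hω]; rfl

theorem form_mlieBracket_sharpForm (h : IsLCS ω θ) (hα : OneFormDiffAt α x)
    (hβ : OneFormDiffAt β x) (hZ : MDiffAt (T% Z) x) :
    ω x (mlieBracket I (fun y ↦ sharpForm ω y (α y)) (fun y ↦ sharpForm ω y (β y)) x) (Z x) =
      - (koszulBracket (assocBi ω) α β x (Z x) - α x (assocVField ω θ x) * β x (Z x)
        + β x (assocVField ω θ x) * α x (Z x) - assocBi ω x (α x) (β x) * θ x (Z x)) := by
  have hω := h.twoForm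
  have hc := h.conf x _ _ Z (hω.mdiffAt_sharpForm hα) (hω.mdiffAt_sharpForm hβ) hZ
  have e1 : (fun y ↦ ω y (sharpForm ω y (β y)) (Z y)) = - fun y ↦ β y (Z y) := by
    ext y; simp [form_sharpForm hω]
  have e2 : (fun y ↦ ω y (sharpForm ω y (α y)) (Z y)) = - fun y ↦ α y (Z y) := by
    ext y; simp [form_sharpForm hω]
  have e3 : (fun y ↦ ω y (sharpForm ω y (α y)) (sharpForm ω y (β y))) =
      fun y ↦ β y (sharpForm ω y (α y)) := by
    ext y; exact assocBi_eq hω y (α y) (β y)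
  have e4 (a : Cotangent I x) (v : TangentSpace I x) : ω x v (sharpForm ω x a) = a v := by
    rw [hω.antisymm, form_sharpForm hω, neg_neg]
  rw [koszulBracket_apply hω hα hβ hZ]
  simp only [extDerivTwo, wedgeOneTwo, e1, e2, e3] at hc
  simp only [mvfderiv_neg, neg_apply, e4, theta_sharpForm (θ := θ) hω, form_sharpForm hω] at hc
  simp only [assocBi_eq hω]
  linear_combination -hc

theorem mlieBracket_sharpForm (h : IsLCS ω θ) (hα : OneFormDiffAt α x)
    (hβ : OneFormDiffAt β x) :
    mlieBracket I (fun y ↦ sharpForm ω y (α y)) (fun y ↦ sharpForm ω y (β y)) x =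
      sharpForm ω x (koszulBracket (assocBi ω) α β x - α x (assocVField ω θ x) • β x
        + β x (assocVField ω θ x) • α x - assocBi ω x (α x) (β x) • θ x) := by
  refine eq_of_form_eq h.twoForm fun Z hZ ↦ ?_
  rw [form_mlieBracket_sharpForm h hα hβ hZ, form_sharpForm h.twoForm]
  simp

theorem mdiffAt_assocVField (h : IsLCS ω θ) : MDiffAt (T% (assocVField ω θ)) x :=
  h.twoForm.mdiffAt_sharpForm (h.smooth.oneFormDiffAt x)

theorem koszulBracket_theta (h : IsLCS ω θ) (hβ : OneFormDiffAt β x) :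
    koszulBracket (assocBi ω) θ β x = lieDeriv (assocVField ω θ) β x := by
  ext v
  obtain ⟨Z, hZ, rfl⟩ := exists_vField_eq x v
  have hω := h.twoForm
  have hc := h.closed x _ Z (hω.mdiffAt_sharpForm hβ) hZ
  rw [koszulBracket_apply hω (h.smooth.oneFormDiffAt x) hβ hZ, lieDeriv_apply hβ hZ]
  have e1 : (fun y ↦ θ y (sharpForm ω y (β y))) = - fun y ↦ β y (assocVField ω θ y) := by
    ext y; exact theta_sharpForm hω _
  have e2 : (fun y ↦ assocBi ω y (θ y) (β y)) = fun y ↦ β y (assocVField ω θ y) := by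
    ext y; rw [assocBi_eq hω]; rfl
  simp only [extDerivOne, e1, mvfderiv_neg, neg_apply] at hc
  rw [e2]
  change _ - β x (mlieBracket I (assocVField ω θ) Z x) - _ - _ = _
  change mvfderiv I (fun y ↦ β y (Z y)) x (assocVField ω θ x) - _ - _ - _ = _
  linear_combination - hc

theorem mlieBracket_assocVField_sharpForm (h : IsLCS ω θ) (hβ : OneFormDiffAt β x) :
    mlieBracket I (assocVField ω θ) (fun y ↦ sharpForm ω y (β y)) x =
      sharpForm ω x (lieDeriv (assocVField ω θ) β x) := by
  have hω := h.twoForm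
  change mlieBracket I (fun y ↦ sharpForm ω y (θ y)) _ x = _
  rw [mlieBracket_sharpForm h (h.smooth.oneFormDiffAt x) hβ, koszulBracket_theta h hβ,
    assocBi_eq hω]
  have h0 : θ x (assocVField ω θ x) = 0 := by
    rw [assocVField, ← assocBi_eq hω]; exact hω.alt x _
  congr 1
  rw [h0]
  change _ - _ + _ - β x (assocVField ω θ x) • θ x = _
  module

theorem mdiffAt_apply_assocVField (h : IsLCS ω θ) (hβ : OneFormDiffAt β x) :
    MDiffAt (fun y ↦ β y (assocVField ω θ y)) x :=
  mdiffAt_apply hβ (mdiffAt_assocVField h)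

theorem koszulBracket_assocVField (h : IsLCS ω θ) (hα : OneFormDiffAt α x)
    (hβ : OneFormDiffAt β x) :
    koszulBracket (assocBi ω) α β x (assocVField ω θ x) =
      mvfderiv I (fun y ↦ β y (assocVField ω θ y)) x (sharpForm ω x (α x))
        - mvfderiv I (fun y ↦ α y (assocVField ω θ y)) x (sharpForm ω x (β x)) := by
  have hω := h.twoForm
  have hξ : MDiffAt (T% (assocVField ω θ)) x := mdiffAt_assocVField h
  have hl := lieDeriv_apply (X := assocVField ω θ) hβ (hω.mdiffAt_sharpForm hα)
  have e : (fun y ↦ assocBi ω y (α y) (β y)) = fun y ↦ β y (sharpForm ω y (α y)) := by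
    ext y; exact assocBi_eq hω _ _ _
  rw [koszulBracket_apply hω hα hβ hξ, e]
  rw [mlieBracket_assocVField_sharpForm h hα] at hl
  rw [mlieBracket_swap_apply (W := assocVField ω θ), mlieBracket_swap_apply (W := assocVField ω θ),
    mlieBracket_assocVField_sharpForm h hβ, mlieBracket_assocVField_sharpForm h hα]
  simp only [map_neg]
  have e3 := assocBi_antisymm hω x (lieDeriv (assocVField ω θ) β x) (α x)
  rw [assocBi_eq hω, assocBi_eq hω] at e3
  linear_combination hl - e3

theorem mdiffAt_sharpLCS (h : IsLCS ω θ) (hβ : OneFormDiffAt β x) :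
    MDiffAt (T% (fun y ↦ sharpLCS ω θ y (β y))) x := by
  simp only [sharpLCS_eq h.twoForm]
  exact mdifferentiableAt_add_section (h.twoForm.mdiffAt_sharpForm hβ)
    ((mdiffAt_apply_assocVField h hβ).smul_section (mdiffAt_assocVField h))

/-- The anchor maps the bracket of one-forms to the Lie bracket of vector fields. -/
theorem sharpLCS_jacobiBracket {g : Cov2 I M} (h : IsLCS ω θ) (hg : IsPseudoRiemannianMetric g)
    (hass : IsAssociatedMetric ω θ g) (hα : OneFormDiffAt α x) (hβ : OneFormDiffAt β x) :
    sharpLCS ω θ x (jacobiBracket (assocBi ω) (assocVField ω θ)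
        (lambdaForm (assocBi ω) (assocVField ω θ) g) α β x) =
      mlieBracket I (fun y ↦ sharpLCS ω θ y (α y)) (fun y ↦ sharpLCS ω θ y (β y)) x := by
  have : CompleteSpace E := FiniteDimensional.complete ℝ E
  have hω := h.twoForm
  have hξ : MDiffAt (T% (assocVField ω θ)) x := mdiffAt_assocVField h
  have e (γ : OneForm I M) : (fun y ↦ sharpLCS ω θ y (γ y)) =
      (fun y ↦ sharpForm ω y (γ y)) + (fun y ↦ γ y (assocVField ω θ y)) • assocVField ω θ := by
    ext y; simp [sharpLCS_eq hω]
  have ha := mdiffAt_apply_assocVField h hα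
  have hb := mdiffAt_apply_assocVField h hβ
  have hX := hω.mdiffAt_sharpForm hα
  have hY := hω.mdiffAt_sharpForm hβ
  have h0 : θ x (assocVField ω θ x) = 0 := by
    rw [assocVField, ← assocBi_eq hω]; exact hω.alt x _
  have hla := lieDeriv_apply (X := assocVField ω θ) hα hξ
  have hlb := lieDeriv_apply (X := assocVField ω θ) hβ hξ
  rw [mlieBracket_self, Pi.zero_apply, map_zero, sub_zero] at hla hlb
  rw [lambdaForm_eq hω hg hass, e, e,
    mlieBracket_add_left hX (ha.smul_section hξ),
    mlieBracket_add_right hY (hb.smul_section hξ),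
    mlieBracket_add_right (V := _ • _) hY (hb.smul_section hξ),
    mlieBracket_smul_right hb hξ, mlieBracket_smul_left ha hξ,
    mlieBracket_smul_left (W := _ • _) ha hξ,
    mlieBracket_smul_right hb hξ, mlieBracket_swap_apply (W := assocVField ω θ),
    mlieBracket_sharpForm h hα hβ, mlieBracket_assocVField_sharpForm h hα,
    mlieBracket_assocVField_sharpForm h hβ, mlieBracket_self, sharpLCS_eq hω, jacobiBracket]
  simp only [add_apply, sub_apply, smul_apply, koszulBracket_assocVField h hα hβ, hla, hlb, h0,
    map_add, map_sub, map_smul, Pi.zero_apply, smul_eq_mul]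
  have hθ : sharpForm ω x (θ x) = assocVField ω θ x := rfl
  simp only [Pi.smul_apply', map_smul, smul_eq_mul, hθ]
  module

end Bracket

end LCS

namespace LCS

variable {E : Type*} [NormedAddCommGroup E] [NormedSpace ℝ E] [FiniteDimensional ℝ E]
  {H : Type*} [TopologicalSpace H] {I : ModelWithCorners ℝ E H}
  {M : Type*} [TopologicalSpace M] [ChartedSpace H M]

/-! ### The contravariant Levi-Civita derivative -/

section Equiv

variable [IsManifold I 1 M] {ω g : Cov2 I M} {θ : OneForm I M}

theorem sharpLCS_injective (hg : IsPseudoRiemannianMetric g) (hass : IsAssociatedMetric ω θ g)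
    (x : M) {a b : Cotangent I x} (h : sharpLCS ω θ x a = sharpLCS ω θ x b) : a = b :=
  eq_of_cometric_eq hg fun c ↦ by rw [← hass, ← hass, h]

/-- An injective linear map from the dual of a finite-dimensional space to the space itself is an
isomorphism. -/
noncomputable def dualEquivOfInjective (f : (E →L[ℝ] ℝ) →ₗ[ℝ] E) (hf : Function.Injective f) :
    (E →L[ℝ] ℝ) ≃L[ℝ] E :=
  (LinearEquiv.ofInjectiveOfFinrankEq f hf (by
    rw [← (LinearMap.toContinuousLinearMap : (E →ₗ[ℝ] ℝ) ≃ₗ[ℝ] (E →L[ℝ] ℝ)).finrank_eq]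
    exact Subspace.dual_finrank_eq)).toContinuousLinearEquiv

/-- The isomorphism `♯_{ω,θ} : T*M → TM` of an associated metric. -/
noncomputable def sharpEquiv (hω : IsNondegenerateTwoForm ω) (hg : IsPseudoRiemannianMetric g)
    (hass : IsAssociatedMetric ω θ g) (x : M) : Cotangent I x ≃L[ℝ] TangentSpace I x :=
  let f : Cotangent I x →ₗ[ℝ] TangentSpace I x :=
    { toFun := sharpLCS ω θ x
      map_add' := fun a b ↦ by
        simp only [sharpLCS_eq hω, map_add, add_apply]; module
      map_smul' := fun c a ↦ by
        simp only [sharpLCS_eq hω, map_smul, smul_apply, smul_eq_mul, RingHom.id_apply]; module }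
  dualEquivOfInjective (E := E) f fun _ _ h ↦ sharpLCS_injective hg hass x h

theorem sharpEquiv_apply (hω : IsNondegenerateTwoForm ω) (hg : IsPseudoRiemannianMetric g)
    (hass : IsAssociatedMetric ω θ g) (x : M) (a : Cotangent I x) :
    sharpEquiv hω hg hass x a = sharpLCS ω θ x a := rfl

theorem sharpLCS_sharpEquiv_symm (hω : IsNondegenerateTwoForm ω)
    (hg : IsPseudoRiemannianMetric g) (hass : IsAssociatedMetric ω θ g) (x : M)
    (v : TangentSpace I x) : sharpLCS ω θ x ((sharpEquiv hω hg hass x).symm v) = v :=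
  (sharpEquiv hω hg hass x).apply_symm_apply v

end Equiv

variable [IsManifold I ((⊤ : ℕ∞) : WithTop ℕ∞) M] {ω g : Cov2 I M} {θ : OneForm I M}

/-- The derivative `D_α β = ♯⁻¹ (∇_{♯ α} ♯ β)` transported from a connection by `♯ = ♯_{ω,θ}`. -/
noncomputable def transportedDeriv (hω : IsNondegenerateTwoForm ω)
    (hg : IsPseudoRiemannianMetric g) (hass : IsAssociatedMetric ω θ g)
    (nabla : CovariantDerivative I E (TangentSpace I : M → Type _)) (β : OneForm I M) (x : M) :
    Cotangent I x →L[ℝ] Cotangent I x :=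
  (sharpEquiv hω hg hass x).symm.toContinuousLinearMap.comp
    ((nabla (fun y ↦ sharpLCS ω θ y (β y)) x).comp
      (sharpEquiv hω hg hass x).toContinuousLinearMap)

theorem sharpLCS_transportedDeriv (hω : IsNondegenerateTwoForm ω)
    (hg : IsPseudoRiemannianMetric g) (hass : IsAssociatedMetric ω θ g)
    (nabla : CovariantDerivative I E (TangentSpace I : M → Type _)) (β : OneForm I M) (x : M)
    (a : Cotangent I x) :
    sharpLCS ω θ x (transportedDeriv hω hg hass nabla β x a) =
      nabla (fun y ↦ sharpLCS ω θ y (β y)) x (sharpLCS ω θ x a) :=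
  sharpLCS_sharpEquiv_symm hω hg hass x _

theorem isContravariantLeviCivita_transportedDeriv (h : IsLCS ω θ)
    (hg : IsPseudoRiemannianMetric g) (hass : IsAssociatedMetric ω θ g)
    {nabla : CovariantDerivative I E (TangentSpace I : M → Type _)} (hn : IsLeviCivita g nabla) :
    IsContravariantLeviCivita (assocBi ω) (assocVField ω θ) g
      (transportedDeriv h.twoForm hg hass nabla) where
  add x β β' hβ hβ' := by
    ext1 a
    apply sharpLCS_injective hg hass x
    have e : (fun y ↦ sharpLCS ω θ y ((β + β') y)) =
        (fun y ↦ sharpLCS ω θ y (β y)) + fun y ↦ sharpLCS ω θ y (β' y) := by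
      ext y; exact map_add (sharpEquiv h.twoForm hg hass y) (β y) (β' y)
    rw [sharpLCS_transportedDeriv, e,
      nabla.isCovariantDerivativeOnUniv.add (mdiffAt_sharpLCS h hβ) (mdiffAt_sharpLCS h hβ')]
    rw [add_apply, add_apply, ← sharpEquiv_apply h.twoForm hg hass x (_ + _), map_add,
      sharpEquiv_apply, sharpEquiv_apply, sharpLCS_transportedDeriv, sharpLCS_transportedDeriv]
  leibniz x f β a hf hβ := by
    apply sharpLCS_injective hg hass x
    have e : (fun y ↦ sharpLCS ω θ y (f y • β y)) = f • fun y ↦ sharpLCS ω θ y (β y) := by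
      ext y; exact map_smul (sharpEquiv h.twoForm hg hass y) (f y) (β y)
    rw [sharpLCS_transportedDeriv, e,
      nabla.isCovariantDerivativeOnUniv.leibniz (mdiffAt_sharpLCS h hβ) hf]
    rw [← sharpEquiv_apply h.twoForm hg hass _ (_ + _), map_add, map_smul, map_smul,
      sharpEquiv_apply, sharpEquiv_apply, sharpLCS_transportedDeriv]
    rfl
  symm x α β hα hβ := by
    apply sharpLCS_injective hg hass x
    rw [sharpLCS_jacobiBracket h hg hass hα hβ,
      ← hn.torsion x _ _ (mdiffAt_sharpLCS h hα) (mdiffAt_sharpLCS h hβ),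
      ← sharpEquiv_apply h.twoForm hg hass _ (_ - _), map_sub, sharpEquiv_apply, sharpEquiv_apply,
      sharpLCS_transportedDeriv, sharpLCS_transportedDeriv]
  metric x a β γ hβ hγ := by
    have e : (fun y ↦ cometric g y (β y) (γ y)) =
        fun y ↦ g y (sharpLCS ω θ y (β y)) (sharpLCS ω θ y (γ y)) := by
      ext y; exact (hass y _ _).symm
    rw [e, ← hass, ← hass, sharpLCS_transportedDeriv, sharpLCS_transportedDeriv]
    exact hn.metric x _ _ _ (mdiffAt_sharpLCS h hβ) (mdiffAt_sharpLCS h hγ)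

theorem cometric_sub_left (hg : IsPseudoRiemannianMetric g) (x : M) (a b c : Cotangent I x) :
    cometric g x (a - b) c = cometric g x a c - cometric g x b c := by
  simp [cometric_eq hg]

/-- The contravariant Levi-Civita derivative is unique on differentiable one-forms. -/
theorem IsContravariantLeviCivita.unique (hg : IsPseudoRiemannianMetric g) {P : Contra2 I M}
    {ξ : VField I M} {D D' : OneForm I M → Π x : M, Cotangent I x →L[ℝ] Cotangent I x}
    (hD : IsContravariantLeviCivita P ξ g D) (hD' : IsContravariantLeviCivita P ξ g D')
    {α β : OneForm I M} {x : M} (hα : OneFormDiffAt α x) (hβ : OneFormDiffAt β x) :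
    D β x (α x) = D' β x (α x) := by
  refine eq_of_cometric_eq hg fun c ↦ ?_
  obtain ⟨γ, hγ, rfl⟩ := exists_oneForm_eq x c
  let t (α β γ : OneForm I M) : ℝ := cometric g x (D β x (α x) - D' β x (α x)) (γ x)
  have hs {α β γ : OneForm I M} (hα : OneFormDiffAt α x) (hβ : OneFormDiffAt β x) :
      t α β γ = t β α γ := by
    have h := (hD.symm x α β hα hβ).trans (hD'.symm x α β hα hβ).symm
    have h' : D β x (α x) - D' β x (α x) = D α x (β x) - D' α x (β x) := by
      rw [sub_eq_iff_eq_add] at h ⊢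
      rw [h]; abel
    simp only [t, h']
  have ha {α β γ : OneForm I M} (hβ : OneFormDiffAt β x) (hγ : OneFormDiffAt γ x) :
      t α β γ = - t α γ β := by
    have h := (hD.metric x (α x) β γ hβ hγ).symm.trans (hD'.metric x (α x) β γ hβ hγ)
    rw [cometric_symm hg x (β x), cometric_symm hg x (β x)] at h
    simp only [t, cometric_sub_left hg]
    linarith
  have h1 := ha (α := α) hβ hγ
  have h2 := hs (γ := β) hα hγ
  have h3 := ha (α := γ) hα hβ
  have h4 := hs (γ := α) hγ hβ
  have h5 := ha (α := β) hγ hα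
  have h6 := hs (γ := γ) hβ hα
  have h0 : t α β γ = 0 := by linarith
  simp only [t, cometric_sub_left hg] at h0
  linarith

end LCS

theorem mainTheorem10 {E : Type*} [NormedAddCommGroup E] [NormedSpace ℝ E] [FiniteDimensional ℝ E]
    {H : Type*} [TopologicalSpace H] {I : ModelWithCorners ℝ E H}
    {M : Type*} [TopologicalSpace M] [ChartedSpace H M]
    [IsManifold I ((⊤ : ℕ∞) : WithTop ℕ∞) M] [BoundarylessManifold I M]
    (ω : LCS.Cov2 I M) (θ : LCS.OneForm I M) (g : LCS.Cov2 I M)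
    (hωθ : LCS.IsLCS ω θ) (hg : LCS.IsPseudoRiemannianMetric g)
    (hass : LCS.IsAssociatedMetric ω θ g) :
    (∃ D, LCS.IsContravariantLeviCivita (LCS.assocBi ω) (LCS.assocVField ω θ) g D) ∧
    (∃ nabla, LCS.IsLeviCivita g nabla) ∧
    ∀ D nabla, LCS.IsContravariantLeviCivita (LCS.assocBi ω) (LCS.assocVField ω θ) g D →
      LCS.IsLeviCivita g nabla →
      (∀ α β : LCS.OneForm I M, LCS.SmoothOneForm α → LCS.SmoothOneForm β → ∀ x : M,
        LCS.sharpLCS ω θ x (D β x (α x)) =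
          nabla (fun y ↦ LCS.sharpLCS ω θ y (β y)) x (LCS.sharpLCS ω θ x (α x))) ∧
      (∀ α β γ : LCS.OneForm I M, LCS.SmoothOneForm α → LCS.SmoothOneForm β →
        LCS.SmoothOneForm γ → ∀ x : M,
        LCS.contraDerivBi (LCS.assocBi ω) (LCS.assocVField ω θ) D α β γ x =
          LCS.covDerivTwo ω nabla (fun y ↦ LCS.sharpLCS ω θ y (α y))
            (fun y ↦ LCS.sharpLCS ω θ y (β y)) (fun y ↦ LCS.sharpLCS ω θ y (γ y)) x) := by
  obtain ⟨nabla₀, hn₀⟩ := LCS.exists_isLeviCivita hg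
  refine ⟨⟨_, LCS.isContravariantLeviCivita_transportedDeriv hωθ hg hass hn₀⟩, ⟨nabla₀, hn₀⟩,
    fun D nabla hD hn ↦ ?_⟩
  have key (α β : LCS.OneForm I M) (hα : LCS.SmoothOneForm α) (hβ : LCS.SmoothOneForm β) (x : M) :
      LCS.sharpLCS ω θ x (D β x (α x)) =
        nabla (fun y ↦ LCS.sharpLCS ω θ y (β y)) x (LCS.sharpLCS ω θ x (α x)) := by
    rw [hD.unique hg (LCS.isContravariantLeviCivita_transportedDeriv hωθ hg hass hn)
      (hα.oneFormDiffAt x) (hβ.oneFormDiffAt x), LCS.sharpLCS_transportedDeriv]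
  refine ⟨key, fun α β γ hα hβ hγ x ↦ ?_⟩
  simp only [LCS.contraDerivBi, LCS.covDerivTwo, ← key α β hα hβ x, ← key α γ hα hγ x,
    LCS.form_sharpLCS hωθ.twoForm]
  rfl
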